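/- **Setting.** There are $n$ replicas. An unknown set of at most $f$ of them is Byzantine, and the others are honest. Replicas know $f$, a validity predicate on transaction requests, a hash function $\mathcal H$ on batches (finite lists of requests), and a deterministic function $\mathrm{tobatch}$ that lists a finite set of requests without repetition. A *signed batch tag* is a triple $(id,h,\sigma)$, where $\sigma$ is a collection of replica signatures; it is *certified* if $\sigma$ contains signatures of at least $f+1$ distinct replicas on $(id,h)$. **Honest replicas.** Each honest replica extends an honest SBC (Set Byzantine Consensus) replica and acts as follows. - On $\mathrm{add}(tr)$ with $tr$ valid: it submits $tr$ to its SBC replica, which records $tr$ as known and sends it to all replicas. A valid element received is recorded as known. - In each SBC round $i=0,1,2,\dots$, taken in order, it makes one proposal. The proposal is a set of known elements that contains every known element not yet decided. - When round $i$ decides the set $E$: it computes $b=\mathrm{tobatch}(E)$ and $h=\mathcal H(b)$, stores $b$ under $(i,h)$ in the map $\mathit{hashes}$, signs $(i,h)$ and sends the signature to all replicas. It stores all signatures that it receives. - In its turn: let $k$ be the least identifier for which the L1 contract *logger* has accepted no tag. If, for some $h$, it has received signatures of at least $f+1$ replicas on $(k,h)$, it posts $(k,h,\sigma)$ to L1,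 where $\sigma$ consists of all the signatures on $(k,h)$ it has received. - On $\mathrm{translate}(id,h)$: it answers $\mathit{hashes}(id,h)$ if this is defined. Otherwise it answers *invalidHash* if some batch is stored with identifier $id$, and *invalidId* if none is. The logger accepts a posted tag exactly if the tag is certified and no tag with the same identifier was accepted before. **Executions.** Events occur in any order chosen by an adversary. Byzantine replicas may send messages, propose sets and post tags arbitrarily. They cannot forge signatures: they can use only Byzantine replicas' signatures and those already issued by honest replicas, and the valid requests they send or propose have been added by L2 users before. Messages between honest replicas are eventually delivered, every transaction submitted to L1 is eventually executed (in any order), the turn of every honest replica recurs infinitely often, and an honest replica with an undecided known element eventually makes a proposal or sees the element decided. No two distinct batches hashed in the execution (by any party) have the same hash. The SBC properties hold: - *Termination*: in every round in which some honest replica has proposed, every honest replica eventually decides. - *Agreement*: honest replicas decide the same set in the same round. - *Validity*: a decided set is a non-empty subset of the union of the sets proposed earlier in that round, and contains only valid elements. - *Censorship-Resistance*: a valid element proposed by all honest replicas in some round is in a set decided by an honest replica in some round. - *Integrity*: sets decided in different rounds are disjoint. **Legal tags.** At a given time, the batch of a tag $(id,h,\sigma)$ is a batch $b$ hashed so far with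 $\mathcal H(b)=h$. The tag is *legal* at that time if it is certified and has a batch $b$ such that every request in $b$ is valid and has been added by an L2 user, no request appears twice in $b$, and no request of $b$ occurs in the batch of a previously accepted tag that was legal when accepted and whose pair of identifier and hash differs from $(id,h)$. **Theorem.** If $f<n/3$, the arranger is correct, that is, every such execution satisfies: - *Legality*: every certified tag posted by any replica is legal, from its posting on. - *Unique Batch*: two certified tags with the same identifier whose signatures are available (made by Byzantine replicas, or issued by honest ones) have the same hash. - *Termination*: every valid request added to an honest replica eventually occurs in the batch of a posted tag that the logger accepts and that is legal at that time. - *Availability*: for every posted legal tag $(id,h,\sigma)$ and every batch $b$ hashed in the execution with $\mathcal H(b)=h$, some honest replica answers $b$ to $\mathrm{translate}(id,h)$ at all later times. -/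

import Mathlib

/-!
# A fully decentralized arranger built on Set Byzantine Consensus

Replicas are the elements of `Fin n`, `Tx` is the type of transaction requests, `Hash` the type of
hash values.  Cryptography is symbolic: a signature is a term naming its signer and its message,
and unforgeability is a restriction on what Byzantine replicas can send and post.  An execution is
an infinite sequence of events; the adversary chooses the events, in any order and interleaving.
-/

namespace Arranger

/-- The static data of an arranger of `n` replicas. -/
structure Params (Tx Hash : Type*) (n : ℕ) where
  /-- The known bound on the number of Byzantine replicas. -/
  f : ℕ
  /-- The Byzantine replicas; all others are honest. -/
  byz : Finset (Fin n)
  /-- Local validity check of a transaction request (well-formed and signed by its originator). -/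
  valid : Tx → Prop
  /-- The public hash function on batches. -/
  hash : List Tx → Hash
  /-- Deterministic ordering of a consented set into a batch: a listing of the set. -/
  toBatch : (S : Finset Tx) → {b : List Tx // b.Nodup ∧ ∀ e, e ∈ b ↔ e ∈ S}

/-- The signature of `signer` on the batch tag `(id, hash)`. -/
structure Signature (Hash : Type*) (n : ℕ) where
  signer : Fin n
  id : ℕ
  hash : Hash

/-- A signed batch tag `(id, hash, σ)`; the combined signature `σ` is the collection of the
individual signatures, which in particular identifies the signers. -/
structure SignedTag (Hash : Type*) (n : ℕ) where
  id : ℕ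
  hash : Hash
  sig : Set (Signature Hash n)

/-- Network messages: `elem e` disseminates an element submitted to an SBC replica, `sig g`
carries a signature. -/
inductive Msg (Tx Hash : Type*) (n : ℕ) where
  | elem (e : Tx)
  | sig (g : Signature Hash n)

/-- Local state of an honest arranger replica, including its SBC part. -/
structure Local (Tx Hash : Type*) (n : ℕ) where
  /-- SBC: the elements known to the replica. -/
  known : Set Tx
  /-- SBC: the union of the decided sets delivered so far. -/
  decided : Set Tx
  /-- SBC: the current round, which is also the number of delivered rounds. -/
  round : ℕ
  /-- SBC: whether the replica has made its proposal for the current round. -/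
  proposed : Prop
  /-- The map `hashes` from pairs (identifier, hash) to batches. -/
  hashes : ℕ → Hash → Option (List Tx)
  /-- The set `signatures` of received signatures on batch tags. -/
  signatures : Set (Signature Hash n)

/-- Global state. -/
structure State (Tx Hash : Type*) (n : ℕ) where
  loc : Fin n → Local Tx Hash n
  /-- All messages (source, destination, content) sent so far. -/
  net : Set (Fin n × Fin n × Msg Tx Hash n)
  /-- The transaction requests that L2 users have added so far, at any replica. -/
  added : Set Tx
  /-- The signatures produced so far by honest replicas. -/
  issued : Set (Signature Hash n)
  /-- The batches on which some party, honest or not, has evaluated the hash function so far. -/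
  hashed : Set (List Tx)
  /-- The `post` transactions (replica, signed batch tag) submitted so far to L1. -/
  posted : Set (Fin n × SignedTag Hash n)
  /-- The signed batch tags accepted so far by the `logger` contract. -/
  accepted : Set (SignedTag Hash n)

inductive Event (Tx Hash : Type*) (n : ℕ) where
  /-- Nothing happens. -/
  | idle
  /-- An L2 user invokes `add(e)` at replica `r`. -/
  | add (r : Fin n) (e : Tx)
  /-- A Byzantine replica sends a message. -/
  | byzSend (src dst : Fin n) (m : Msg Tx Hash n)
  /-- `dst` receives the message `m` of `src`. -/
  | recv (src dst : Fin n) (m : Msg Tx Hash n)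
  /-- Replica `r` proposes the set `E` in SBC round `i`. -/
  | propose (r : Fin n) (i : ℕ) (E : Finset Tx)
  /-- `SetDeliver(i, E)` at the honest replica `r`. -/
  | setDeliver (r : Fin n) (i : ℕ) (E : Finset Tx)
  /-- `myturn` at the honest replica `r`. -/
  | turn (r : Fin n)
  /-- A Byzantine replica submits a signed batch tag to L1. -/
  | byzPost (r : Fin n) (tag : SignedTag Hash n)
  /-- L1 executes the submitted transaction in which `r` posts `tag` to the `logger`. -/
  | execute (r : Fin n) (tag : SignedTag Hash n)
  /-- Some party (a Byzantine replica, a client, ...) evaluates the hash function on `b`. -/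
  | evalHash (b : List Tx)

variable {Tx Hash : Type*} {n : ℕ}

def State.initial : State Tx Hash n where
  loc := fun _ =>
    { known := ∅, decided := ∅, round := 0, proposed := False,
      hashes := fun _ _ => none, signatures := ∅ }
  net := ∅
  added := ∅
  issued := ∅
  hashed := ∅
  posted := ∅
  accepted := ∅

/-- A signed batch tag is certified when it contains signatures of at least `f + 1` replicas. -/
def Certified (P : Params Tx Hash n) (tag : SignedTag Hash n) : Prop :=
  P.f + 1 ≤ {r : Fin n | (⟨r, tag.id, tag.hash⟩ : Signature Hash n) ∈ tag.sig}.ncard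

/-- The elements that a replica knows and that are in no decided set delivered to it. -/
def Local.pending (l : Local Tx Hash n) : Set Tx := l.known \ l.decided

/-- `nextBatch`: the least identifier without a batch tag in the `logger`. -/
def IsNextBatch (s : State Tx Hash n) (k : ℕ) : Prop :=
  IsLeast {i | ∀ tag ∈ s.accepted, tag.id ≠ i} k

/-- The tag that `r` posts in its turn: its identifier is `nextBatch` and it carries all
signatures on it that `r` has received, which have to be enough for a certified batch tag. -/
def ReadyToPost (P : Params Tx Hash n) (s : State Tx Hash n) (r : Fin n)
    (tag : SignedTag Hash n) : Prop :=
  IsNextBatch s tag.id ∧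
  tag.sig = {g | g ∈ (s.loc r).signatures ∧ g.id = tag.id ∧ g.hash = tag.hash} ∧
  Certified P tag

/-- Signatures available to Byzantine replicas: their own on any message, and those that honest
replicas have issued. -/
def CanSign (P : Params Tx Hash n) (s : State Tx Hash n) (g : Signature Hash n) : Prop :=
  g.signer ∈ P.byz ∨ g ∈ s.issued

/-- Elements available to Byzantine replicas: they cannot impersonate L2 users, so the valid ones
among them have been added by L2 users. -/
def CanShow (P : Params Tx Hash n) (s : State Tx Hash n) (e : Tx) : Prop :=
  P.valid e → e ∈ s.added

/-- A signed batch tag all of whose signatures are available in state `s`. -/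
def Available (P : Params Tx Hash n) (s : State Tx Hash n) (tag : SignedTag Hash n) : Prop :=
  ∀ g ∈ tag.sig, CanSign P s g

/-- When an event may occur. -/
def Enabled (P : Params Tx Hash n) (s : State Tx Hash n) : Event Tx Hash n → Prop
  | .idle => True
  | .add _ _ => True
  | .byzSend src _ m => src ∈ P.byz ∧
      (match m with
      | .elem e => CanShow P s e
      | .sig g => CanSign P s g)
  | .recv src dst m => (src, dst, m) ∈ s.net
  | .propose r i E =>
      if r ∈ P.byz then ∀ e ∈ E, CanShow P s e
      else i = (s.loc r).round ∧ ¬ (s.loc r).proposed ∧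
        (s.loc r).pending ⊆ (E : Set Tx) ∧ (E : Set Tx) ⊆ (s.loc r).known
  | .setDeliver r i _ => r ∉ P.byz ∧ i = (s.loc r).round ∧ (s.loc r).proposed
  | .turn r => r ∉ P.byz
  | .byzPost r tag => r ∈ P.byz ∧ Available P s tag
  | .execute r tag => (r, tag) ∈ s.posted
  | .evalHash _ => True

open Classical in
/-- The effect of an event; at honest replicas this is the arranger protocol. -/
noncomputable def next (P : Params Tx Hash n) (s : State Tx Hash n) :
    Event Tx Hash n → State Tx Hash n
  | .idle => s
  -- A valid request is added to the SBC replica, which disseminates it to all replicas.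
  | .add r e =>
      if r ∈ P.byz ∨ ¬ P.valid e then { s with added := s.added ∪ {e} }
      else { s with
        added := s.added ∪ {e}
        loc := Function.update s.loc r { s.loc r with known := (s.loc r).known ∪ {e} }
        net := s.net ∪ {p | ∃ q, p = (r, q, .elem e)} }
  | .byzSend src dst m => { s with net := s.net ∪ {(src, dst, m)} }
  | .recv _ dst m => { s with
      loc := Function.update s.loc dst
        (match m with
        | .elem e =>
            if P.valid e then { s.loc dst with known := (s.loc dst).known ∪ {e} } else s.loc dst
        | .sig g => { s.loc dst with signatures := (s.loc dst).signatures ∪ {g} }) }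
  | .propose r _ _ => { s with
      loc := Function.update s.loc r { s.loc r with proposed := True } }
  -- Order the consented set into a batch, hash it, store it in `hashes`, sign the new batch tag
  -- and broadcast the signature.
  | .setDeliver r i E =>
      let b := (P.toBatch E).1
      let h := P.hash b
      let g : Signature Hash n := ⟨r, i, h⟩
      { s with
        loc := Function.update s.loc r { s.loc r with
          decided := (s.loc r).decided ∪ (E : Set Tx)
          round := (s.loc r).round + 1
          proposed := False
          hashes := fun i' h' => if i' = i ∧ h' = h then some b else (s.loc r).hashes i' h' }
        hashed := s.hashed ∪ {b}
        issued := s.issued ∪ {g}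
        net := s.net ∪ {p | ∃ q, p = (r, q, .sig g)} }
  | .turn r => { s with posted := s.posted ∪ {p | p.1 = r ∧ ReadyToPost P s r p.2} }
  | .byzPost r tag => { s with posted := s.posted ∪ {(r, tag)} }
  -- The contract accepts certified tags only, and only the first one per identifier.
  | .execute _ tag => { s with
      accepted := s.accepted ∪
        {tag' | tag' = tag ∧ Certified P tag ∧ ∀ old ∈ s.accepted, old.id ≠ tag.id} }
  | .evalHash b => { s with hashed := s.hashed ∪ {b} }

/-- The state before the `t`-th event of the sequence `ev`. -/
noncomputable def stateAt (P : Params Tx Hash n) (ev : ℕ → Event Tx Hash n) :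
    ℕ → State Tx Hash n
  | 0 => State.initial
  | t + 1 => next P (stateAt P ev t) (ev t)

/-- Answers of `translate`. -/
inductive Answer (Tx : Type*) where
  | batch (b : List Tx)
  | invalidHash
  | invalidId

open Classical in
/-- `translate(id, h)` at a replica with local state `l`. -/
noncomputable def translate (l : Local Tx Hash n) (id : ℕ) (h : Hash) : Answer Tx :=
  match l.hashes id h with
  | some b => .batch b
  | none => if ∃ h', l.hashes id h' ≠ none then .invalidHash else .invalidId

/-- The executions of the system. -/
structure IsExecution (P : Params Tx Hash n) (ev : ℕ → Event Tx Hash n) : Prop where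
  enabled : ∀ t, Enabled P (stateAt P ev t) (ev t)
  /-- Messages between honest replicas are eventually delivered. -/
  delivery : ∀ t src dst m, src ∉ P.byz → dst ∉ P.byz →
    (src, dst, m) ∈ (stateAt P ev t).net → ∃ t', ev t' = .recv src dst m
  /-- Every transaction submitted to L1 is eventually executed. -/
  liveL1 : ∀ t r tag, (r, tag) ∈ (stateAt P ev t).posted → ∃ t', ev t' = .execute r tag
  /-- Replicas take turns: the turn of an honest replica comes again and again. -/
  turns : ∀ r, r ∉ P.byz → ∀ t, ∃ t', t ≤ t' ∧ ev t' = .turn r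
  /-- An honest replica with a pending element eventually makes a proposal (enough requests have
  arrived, or a timeout expires), unless the element is decided in the meantime. -/
  rounds : ∀ r, r ∉ P.byz → ∀ t e, e ∈ ((stateAt P ev t).loc r).pending →
    ∃ t', t ≤ t' ∧ (e ∉ ((stateAt P ev t').loc r).pending ∨ ∃ i E, ev t' = .propose r i E)

/-- The properties of Set Byzantine Consensus. -/
structure IsSBC (P : Params Tx Hash n) (ev : ℕ → Event Tx Hash n) : Prop where
  /-- In every round that takes place (some honest replica has proposed in it), every honest
  replica eventually decides. -/
  termination : ∀ i, (∃ q, q ∉ P.byz ∧ ∃ t E, ev t = .propose q i E) →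
    ∀ r, r ∉ P.byz → ∃ t E, ev t = .setDeliver r i E
  agreement : ∀ i r r' t t' E E', r ∉ P.byz → r' ∉ P.byz →
    ev t = .setDeliver r i E → ev t' = .setDeliver r' i E' → E = E'
  /-- A decided set is a non-empty subset of the union of the sets proposed in the round, and
  contains only valid elements. -/
  validity : ∀ i r t E, r ∉ P.byz → ev t = .setDeliver r i E →
    E.Nonempty ∧ ∀ e ∈ E, P.valid e ∧ ∃ t' < t, ∃ q F, ev t' = .propose q i F ∧ e ∈ F
  /-- Valid elements proposed by all honest replicas in a round are eventually decided. -/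
  censorshipResistance : ∀ e, P.valid e →
    (∃ i, ∀ r, r ∉ P.byz → ∃ t E, ev t = .propose r i E ∧ e ∈ E) →
    ∃ j r t E, r ∉ P.byz ∧ ev t = .setDeliver r j E ∧ e ∈ E
  /-- No element is in the decided sets of two rounds. -/
  integrity : ∀ i j r r' t t' E E', r ∉ P.byz → r' ∉ P.byz → i ≠ j →
    ev t = .setDeliver r i E → ev t' = .setDeliver r' j E' → Disjoint E E'

/-- Collision resistance: no two distinct batches hashed in the execution have the same hash. -/
def CollisionFree (P : Params Tx Hash n) (ev : ℕ → Event Tx Hash n) : Prop :=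
  ∀ t, Set.InjOn P.hash (stateAt P ev t).hashed

/-- `b` is the batch of `tag`, among the batches hashed by time `t`. -/
def BatchOf (P : Params Tx Hash n) (ev : ℕ → Event Tx Hash n) (t : ℕ)
    (tag : SignedTag Hash n) (b : List Tx) : Prop :=
  b ∈ (stateAt P ev t).hashed ∧ P.hash b = tag.hash

/-- The `t`-th event makes the `logger` accept `tag`. -/
def AcceptedAt (P : Params Tx Hash n) (ev : ℕ → Event Tx Hash n) (t : ℕ)
    (tag : SignedTag Hash n) : Prop :=
  tag ∉ (stateAt P ev t).accepted ∧ tag ∈ (stateAt P ev (t + 1)).accepted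

/-- `tag` is a legal batch tag at time `t`: it is certified, and its batch consists of valid
requests added by L2 users, has no repetition, and shares no request with a legal batch tag
accepted before `t`.  Posting the same pair `(id, hash)` once more is not counted as a conflict of
the batch tag with itself. -/
def LegalAt (P : Params Tx Hash n) (ev : ℕ → Event Tx Hash n) (t : ℕ)
    (tag : SignedTag Hash n) : Prop :=
  Certified P tag ∧ ∃ b, BatchOf P ev t tag b ∧
    (∀ e ∈ b, P.valid e ∧ e ∈ (stateAt P ev t).added) ∧
    b.Nodup ∧
    ∀ s, s < t → ∀ tag', AcceptedAt P ev s tag' → LegalAt P ev s tag' →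
      ¬ (tag'.id = tag.id ∧ tag'.hash = tag.hash) →
      ∀ b', BatchOf P ev t tag' b' → ∀ e ∈ b, e ∉ b'
termination_by t

/-- Every certified batch tag posted by a replica, honest or Byzantine, is legal. -/
def Legality (P : Params Tx Hash n) (ev : ℕ → Event Tx Hash n) : Prop :=
  ∀ t r tag, (r, tag) ∈ (stateAt P ev t).posted → Certified P tag → LegalAt P ev t tag

/-- Certified batch tags with the same identifier have the same hash. -/
def UniqueBatch (P : Params Tx Hash n) (ev : ℕ → Event Tx Hash n) : Prop :=
  ∀ t tag₁ tag₂, Available P (stateAt P ev t) tag₁ → Available P (stateAt P ev t) tag₂ →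
    Certified P tag₁ → Certified P tag₂ → tag₁.id = tag₂.id → tag₁.hash = tag₂.hash

/-- Every valid request added to an honest replica eventually appears in a posted legal batch tag
accepted by the `logger`. -/
def Termination (P : Params Tx Hash n) (ev : ℕ → Event Tx Hash n) : Prop :=
  ∀ t r e, r ∉ P.byz → P.valid e → ev t = .add r e →
    ∃ s tag b, (∃ q, (q, tag) ∈ (stateAt P ev s).posted) ∧ AcceptedAt P ev s tag ∧
      LegalAt P ev s tag ∧ BatchOf P ev s tag b ∧ e ∈ b

/-- For a posted legal batch tag `(id, h, σ)` with `h = hash b`, some honest replica answers `b`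
to `translate(id, h)`, whenever it is asked from then on. -/
def Availability (P : Params Tx Hash n) (ev : ℕ → Event Tx Hash n) : Prop :=
  ∀ t q tag, (q, tag) ∈ (stateAt P ev t).posted → LegalAt P ev t tag →
    ∀ u b, BatchOf P ev u tag b →
      ∃ r, r ∉ P.byz ∧
        ∀ t', t ≤ t' → translate ((stateAt P ev t').loc r) tag.id tag.hash = .batch b

/-- The arranger is correct: all its executions have the four properties. -/
def Correct (P : Params Tx Hash n) : Prop :=
  ∀ ev : ℕ → Event Tx Hash n, IsExecution P ev → IsSBC P ev → CollisionFree P ev →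
    Legality P ev ∧ UniqueBatch P ev ∧ Termination P ev ∧ Availability P ev

end Arranger

/-!
Safety rests on one observation. A certified tag carries signatures of `f + 1` replicas, at most
`f` of which are Byzantine; if the signatures are available, the honest one among them was issued
when its signer was delivered the set of round `id`, so the hash of the tag is that of the batch
listing this set (`exists_setDeliver_of_certified`). The invariant `Sound` says that every posted
tag has available signatures and that every request in the system that is valid has been added.
SBC agreement then gives uniqueness of the batch, SBC validity its contents, SBC integrity together
with collision resistance the disjointness from the batches of other tags, and the honest signer
itself answers `translate` for ever, since its rounds increase and `hashes` is never overwritten.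

For termination, a valid request added to an honest replica reaches all honest replicas. If it
were never decided it would stay pending everywhere, so honest replicas would keep proposing, and
SBC termination would carry all of them through every round; in a round above all those current when
the request became known, all of them propose it, and censorship resistance decides it after all
(`IsExecution.exists_setDeliver_mem`). Once round `j` is decided, so are all rounds below it, and
their honest signatures reach everybody. By strong induction every identifier up to `j` is taken in
the `logger`: when those below it are, an honest replica with enough signatures posts a tag in its
turn (`IsExecution.exists_accepted_of_setDeliver`). The tag accepted for `j` is legal and, by the
observation above, lists the set decided in round `j`.
-/

namespace Arranger

variable {Tx Hash : Type*} {n : ℕ}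

/-! ### Monotonicity of the global state -/

/-- `Extends s s'`: everything that only grows in an execution is at least as large in `s'` as
in `s`. -/
structure Extends (s s' : State Tx Hash n) : Prop where
  net : s.net ⊆ s'.net
  added : s.added ⊆ s'.added
  issued : s.issued ⊆ s'.issued
  hashed : s.hashed ⊆ s'.hashed
  posted : s.posted ⊆ s'.posted
  accepted : s.accepted ⊆ s'.accepted
  known : ∀ r, (s.loc r).known ⊆ (s'.loc r).known
  signatures : ∀ r, (s.loc r).signatures ⊆ (s'.loc r).signatures
  round : ∀ r, (s.loc r).round ≤ (s'.loc r).round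

theorem Extends.refl (s : State Tx Hash n) : Extends s s := by
  constructor <;> simp

theorem Extends.trans {s s' s'' : State Tx Hash n} (h : Extends s s') (h' : Extends s' s'') :
    Extends s s'' where
  net := h.net.trans h'.net
  added := h.added.trans h'.added
  issued := h.issued.trans h'.issued
  hashed := h.hashed.trans h'.hashed
  posted := h.posted.trans h'.posted
  accepted := h.accepted.trans h'.accepted
  known r := (h.known r).trans (h'.known r)
  signatures r := (h.signatures r).trans (h'.signatures r)
  round r := (h.round r).trans (h'.round r)

theorem extends_next (P : Params Tx Hash n) (s : State Tx Hash n) (a : Event Tx Hash n) :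
    Extends s (next P s a) := by
  cases a with
  | idle => exact Extends.refl s
  | add r e =>
    by_cases hr : r ∈ P.byz ∨ ¬ P.valid e
    · constructor <;> simp [next, hr]
    · constructor <;> simp only [next, hr, if_false] <;>
        first | exact Set.subset_union_left | exact subset_rfl | skip
      all_goals
        intro q
        by_cases hq : q = r
        · subst hq; simp
        · simp [hq]
  | recv src r m =>
    cases m with
    | elem e =>
      by_cases he : P.valid e <;>
      · constructor <;> simp only [next, he, if_true, if_false] <;>
          first | exact subset_rfl | skip
        all_goals
          intro q
          by_cases hq : q = r
          · subst hq; simp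
          · simp [hq]
    | sig g =>
      constructor <;> simp only [next] <;> first | exact subset_rfl | skip
      all_goals
        intro q
        by_cases hq : q = r
        · subst hq; simp
        · simp [hq]
  | propose r i E =>
    constructor <;> simp only [next] <;> first | exact subset_rfl | skip
    all_goals
      intro q
      by_cases hq : q = r
      · subst hq; simp
      · simp [hq]
  | setDeliver r i E =>
    constructor <;> simp only [next] <;>
      first | exact Set.subset_union_left | exact subset_rfl | skip
    all_goals
      intro q
      by_cases hq : q = r
      · subst hq; simp
      · simp [hq]
  | _ => constructor <;> simp [next]

theorem stateAt_extends (P : Params Tx Hash n) (ev : ℕ → Event Tx Hash n) {t u : ℕ}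
    (h : t ≤ u) : Extends (stateAt P ev t) (stateAt P ev u) := by
  induction h with
  | refl => exact Extends.refl _
  | step _ ih => exact ih.trans (extends_next P _ _)

theorem CanSign.mono {P : Params Tx Hash n} {s s' : State Tx Hash n} {g : Signature Hash n}
    (h : CanSign P s g) (hs : Extends s s') : CanSign P s' g :=
  h.imp_right fun hg => hs.issued hg

/-! ### Unforgeability -/

/-- The safety invariant behind unforgeability: every message, local record and posted tag in the
system uses only requests that L2 users have added and signatures that could be made. -/
structure Sound (P : Params Tx Hash n) (s : State Tx Hash n) : Prop where
  net_elem : ∀ src dst e, (src, dst, .elem e) ∈ s.net → CanShow P s e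
  net_sig : ∀ src dst g, (src, dst, .sig g) ∈ s.net → CanSign P s g
  known : ∀ r, ∀ e ∈ (s.loc r).known, P.valid e ∧ e ∈ s.added
  signatures : ∀ r, ∀ g ∈ (s.loc r).signatures, CanSign P s g
  posted : ∀ r tag, (r, tag) ∈ s.posted → Available P s tag

theorem sound_initial (P : Params Tx Hash n) : Sound P State.initial := by
  constructor <;> simp [State.initial]

theorem Sound.next {P : Params Tx Hash n} {s : State Tx Hash n} {a : Event Tx Hash n}
    (hs : Sound P s) (ha : Enabled P s a) : Sound P (next P s a) := by
  have hx := extends_next P s a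
  have show_mono : ∀ {e}, CanShow P s e → CanShow P (Arranger.next P s a) e :=
    fun h hv => hx.added (h hv)
  refine ⟨fun src dst e he => ?_, fun src dst g hg => ?_, fun r e he => ?_, fun r g hg => ?_,
    fun r tag hp => ?_⟩
  · by_cases h0 : (src, dst, Msg.elem e) ∈ s.net
    · exact show_mono (hs.net_elem _ _ _ h0)
    · cases a with
      | add r' e' =>
        by_cases hr : r' ∈ P.byz ∨ ¬ P.valid e'
        · simp [Arranger.next, hr, h0] at he
        · simp [Arranger.next, hr, h0] at he
          obtain ⟨-, rfl⟩ := he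
          intro _
          simp [Arranger.next, hr]
      | byzSend src' dst' m =>
        simp only [Arranger.next, Set.mem_union, h0, false_or, Set.mem_singleton_iff,
          Prod.mk.injEq] at he
        obtain ⟨-, -, rfl⟩ := he
        exact show_mono ha.2
      | _ => simp [Arranger.next, h0] at he
  · by_cases h0 : (src, dst, Msg.sig g) ∈ s.net
    · exact (hs.net_sig _ _ _ h0).mono hx
    · cases a with
      | add r' e' =>
        by_cases hr : r' ∈ P.byz ∨ ¬ P.valid e' <;> simp [Arranger.next, hr, h0] at hg
      | byzSend src' dst' m =>
        simp only [Arranger.next, Set.mem_union, h0, false_or, Set.mem_singleton_iff,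
          Prod.mk.injEq] at hg
        obtain ⟨-, -, rfl⟩ := hg
        exact ha.2.mono hx
      | setDeliver r' i E =>
        simp [Arranger.next, h0] at hg
        obtain ⟨-, rfl⟩ := hg
        exact Or.inr (by simp [Arranger.next])
      | _ => simp [Arranger.next, h0] at hg
  · by_cases h0 : e ∈ (s.loc r).known
    · exact ⟨(hs.known r e h0).1, hx.added (hs.known r e h0).2⟩
    · cases a with
      | add r' e' =>
        by_cases hr : r' ∈ P.byz ∨ ¬ P.valid e'
        · simp [Arranger.next, hr, h0] at he
        · by_cases hrr : r = r'
          · subst hrr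
            simp [Arranger.next, hr, h0] at he
            subst he
            exact ⟨by tauto, by simp [Arranger.next, hr]⟩
          · simp [Arranger.next, hr, h0, hrr] at he
      | recv src dst m =>
        by_cases hrr : r = dst
        · subst hrr
          cases m with
          | elem e' =>
            by_cases hv : P.valid e'
            · simp [Arranger.next, hv, h0] at he
              subst he
              exact ⟨hv, hx.added (hs.net_elem _ _ _ ha hv)⟩
            · simp [Arranger.next, hv, h0] at he
          | sig g => simp [Arranger.next, h0] at he
        · simp [Arranger.next, h0, hrr] at he
      | propose r' i E =>
        by_cases hrr : r = r'
        · subst hrr; simp [Arranger.next, h0] at he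
        · simp [Arranger.next, h0, hrr] at he
      | setDeliver r' i E =>
        by_cases hrr : r = r'
        · subst hrr; simp [Arranger.next, h0] at he
        · simp [Arranger.next, h0, hrr] at he
      | _ => simp [Arranger.next, h0] at he
  · by_cases h0 : g ∈ (s.loc r).signatures
    · exact (hs.signatures r g h0).mono hx
    · cases a with
      | add r' e' =>
        by_cases hr : r' ∈ P.byz ∨ ¬ P.valid e'
        · simp [Arranger.next, hr, h0] at hg
        · by_cases hrr : r = r'
          · subst hrr
            simp [Arranger.next, hr, h0] at hg
          · simp [Arranger.next, hr, h0, hrr] at hg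
      | recv src dst m =>
        by_cases hrr : r = dst
        · subst hrr
          cases m with
          | elem e' => by_cases hv : P.valid e' <;> simp [Arranger.next, hv, h0] at hg
          | sig g' =>
            simp [Arranger.next, h0] at hg
            subst hg
            exact (hs.net_sig _ _ _ ha).mono hx
        · simp [Arranger.next, h0, hrr] at hg
      | propose r' i E =>
        by_cases hrr : r = r'
        · subst hrr; simp [Arranger.next, h0] at hg
        · simp [Arranger.next, h0, hrr] at hg
      | setDeliver r' i E =>
        by_cases hrr : r = r'
        · subst hrr; simp [Arranger.next, h0] at hg
        · simp [Arranger.next, h0, hrr] at hg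
      | _ => simp [Arranger.next, h0] at hg
  · by_cases h0 : (r, tag) ∈ s.posted
    · exact fun g hg => (hs.posted r tag h0 g hg).mono hx
    · cases a with
      | add r' e' =>
        by_cases hr : r' ∈ P.byz ∨ ¬ P.valid e' <;> simp [Arranger.next, hr, h0] at hp
      | turn r' =>
        simp [Arranger.next, h0] at hp
        obtain ⟨rfl, -, hsig, -⟩ := hp
        intro g hg
        rw [hsig] at hg
        exact (hs.signatures _ g hg.1).mono hx
      | byzPost r' tag' =>
        simp [Arranger.next, h0] at hp
        obtain ⟨rfl, rfl⟩ := hp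
        exact fun g hg => (ha.2 g hg).mono hx
      | _ => simp [Arranger.next, h0] at hp

theorem IsExecution.sound {P : Params Tx Hash n} {ev : ℕ → Event Tx Hash n}
    (h : IsExecution P ev) (t : ℕ) : Sound P (stateAt P ev t) := by
  induction t with
  | zero => exact sound_initial P
  | succ t ih => exact ih.next (h.enabled t)

/-! ### Rounds, proposals and deliveries of a replica -/

/-- Only a delivery at `r` changes the decided part of the state of `r`. -/
theorem next_loc_of_ne_setDeliver (P : Params Tx Hash n) (s : State Tx Hash n)
    {a : Event Tx Hash n} {r : Fin n} (ha : ∀ i E, a ≠ .setDeliver r i E) :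
    ((next P s a).loc r).round = (s.loc r).round ∧
      ((next P s a).loc r).decided = (s.loc r).decided ∧
      ((next P s a).loc r).hashes = (s.loc r).hashes := by
  cases a with
  | add r' e =>
    by_cases hr : r' ∈ P.byz ∨ ¬ P.valid e
    · simp [next, hr]
    · by_cases hq : r = r'
      · subst hq; simp [next, hr]
      · simp [next, hr, hq]
  | recv src r' m =>
    by_cases hq : r = r'
    · subst hq
      cases m with
      | elem e => by_cases he : P.valid e <;> simp [next, he]
      | sig g => simp [next]
    · simp [next, hq]
  | propose r' i E =>
    by_cases hq : r = r'
    · subst hq; simp [next]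
    · simp [next, hq]
  | setDeliver r' i E =>
    have hq : r ≠ r' := fun h => ha i E (by rw [h])
    simp [next, hq]
  | _ => simp [next]

/-- A proposal flag that is set was set before, unless the event is a proposal of the replica. -/
theorem proposed_of_next {P : Params Tx Hash n} {s : State Tx Hash n}
    {a : Event Tx Hash n} {r : Fin n} (h : ((next P s a).loc r).proposed)
    (ha : ∀ i E, a ≠ .propose r i E) :
    (s.loc r).proposed ∧ ∀ i E, a ≠ .setDeliver r i E := by
  cases a with
  | add r' e =>
    by_cases hr : r' ∈ P.byz ∨ ¬ P.valid e
    · simpa [next, hr] using h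
    · by_cases hq : r = r'
      · subst hq; simpa [next, hr] using h
      · simpa [next, hr, hq] using h
  | recv src r' m =>
    by_cases hq : r = r'
    · subst hq
      cases m with
      | elem e => by_cases he : P.valid e <;> simpa [next, he] using h
      | sig g => simpa [next] using h
    · simpa [next, hq] using h
  | propose r' i E =>
    have hq : r ≠ r' := fun h => ha i E (by rw [h])
    simpa [next, hq] using h
  | setDeliver r' i E =>
    by_cases hq : r = r'
    · subst hq; simp [next] at h
    · simpa [next, hq, Ne.symm hq] using h
  | _ => simpa [next] using h

variable {P : Params Tx Hash n} {ev : ℕ → Event Tx Hash n}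

theorem round_succ_of_setDeliver {t i : ℕ} {r : Fin n} {E : Finset Tx}
    (h : ev t = .setDeliver r i E) :
    ((stateAt P ev (t + 1)).loc r).round = ((stateAt P ev t).loc r).round + 1 := by
  simp [stateAt, h, next]

theorem IsExecution.round_of_setDeliver (hx : IsExecution P ev) {t i : ℕ} {r : Fin n}
    {E : Finset Tx} (h : ev t = .setDeliver r i E) :
    r ∉ P.byz ∧ i = ((stateAt P ev t).loc r).round ∧ ((stateAt P ev t).loc r).proposed := by
  have := hx.enabled t
  rwa [h] at this

theorem IsExecution.round_of_propose (hx : IsExecution P ev) {t i : ℕ} {r : Fin n}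
    {E : Finset Tx} (hr : r ∉ P.byz) (h : ev t = .propose r i E) :
    i = ((stateAt P ev t).loc r).round ∧ ¬ ((stateAt P ev t).loc r).proposed ∧
      ((stateAt P ev t).loc r).pending ⊆ (E : Set Tx) ∧
      (E : Set Tx) ⊆ ((stateAt P ev t).loc r).known := by
  have := hx.enabled t
  rw [h] at this
  simpa only [Enabled, hr, if_false] using this

/-- Every round below the current one has been delivered. -/
theorem IsExecution.exists_setDeliver_of_lt_round (hx : IsExecution P ev) {t i : ℕ} {r : Fin n}
    (h : i < ((stateAt P ev t).loc r).round) : ∃ u < t, ∃ E, ev u = .setDeliver r i E := by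
  induction t with
  | zero => simp [stateAt, State.initial] at h
  | succ t ih =>
    by_cases hlt : i < ((stateAt P ev t).loc r).round
    · obtain ⟨u, hu, hE⟩ := ih hlt
      exact ⟨u, by omega, hE⟩
    · by_cases ha : ∀ j E, ev t ≠ .setDeliver r j E
      · have := (next_loc_of_ne_setDeliver P (stateAt P ev t) ha).1
        rw [stateAt, this] at h
        exact absurd h hlt
      · push Not at ha
        obtain ⟨j, E, hE⟩ := ha
        have h1 := round_succ_of_setDeliver (P := P) hE
        have h2 := (hx.round_of_setDeliver hE).2.1
        obtain rfl : j = i := by omega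
        exact ⟨t, by omega, E, hE⟩

theorem exists_setDeliver_of_mem_decided {t : ℕ} {r : Fin n} {e : Tx}
    (h : e ∈ ((stateAt P ev t).loc r).decided) : ∃ u i E, ev u = .setDeliver r i E ∧ e ∈ E := by
  induction t with
  | zero => simp [stateAt, State.initial] at h
  | succ t ih =>
    by_cases ha : ∀ j E, ev t ≠ .setDeliver r j E
    · have := (next_loc_of_ne_setDeliver P (stateAt P ev t) ha).2.1
      rw [stateAt, this] at h
      exact ih h
    · push Not at ha
      obtain ⟨j, E, hE⟩ := ha
      simp only [stateAt, hE, next, Function.update_self] at h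
      rcases h with h | h
      · exact ih h
      · exact ⟨t, j, E, hE, h⟩

/-- The proposal flag of an honest replica records a proposal for its current round. -/
theorem IsExecution.exists_propose_of_proposed (hx : IsExecution P ev) {t : ℕ} {r : Fin n}
    (hr : r ∉ P.byz) (h : ((stateAt P ev t).loc r).proposed) :
    ∃ u < t, ∃ E, ev u = .propose r ((stateAt P ev t).loc r).round E := by
  induction t with
  | zero => simp [stateAt, State.initial] at h
  | succ t ih =>
    by_cases ha : ∀ j E, ev t ≠ .propose r j E
    · obtain ⟨h1, h2⟩ := proposed_of_next h ha
      rw [stateAt, (next_loc_of_ne_setDeliver P _ h2).1]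
      obtain ⟨u, hu, hE⟩ := ih h1
      exact ⟨u, by omega, hE⟩
    · push Not at ha
      obtain ⟨j, E, hE⟩ := ha
      refine ⟨t, by omega, E, ?_⟩
      have h2 : ∀ i E, ev t ≠ .setDeliver r i E := by simp [hE]
      rw [stateAt, (next_loc_of_ne_setDeliver P _ h2).1, ← (hx.round_of_propose hr hE).1, hE]

theorem IsExecution.exists_propose_of_setDeliver (hx : IsExecution P ev) {t i : ℕ} {r : Fin n}
    {E : Finset Tx} (h : ev t = .setDeliver r i E) : ∃ u < t, ∃ F, ev u = .propose r i F := by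
  obtain ⟨hr, hi, hp⟩ := hx.round_of_setDeliver h
  obtain ⟨u, hu, hF⟩ := hx.exists_propose_of_proposed hr hp
  exact ⟨u, hu, hi ▸ hF⟩

/-- A delivered batch stays in `hashes`: identifiers are never reused, since rounds increase. -/
theorem IsExecution.hashes_of_setDeliver (hx : IsExecution P ev) {u t i : ℕ} {r : Fin n}
    {E : Finset Tx} (h : ev u = .setDeliver r i E) (hut : u < t) :
    ((stateAt P ev t).loc r).hashes i (P.hash (P.toBatch E).1) = some (P.toBatch E).1 := by
  induction t, hut using Nat.le_induction with
  | base => simp [stateAt, h, next]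
  | succ t hut ih =>
    by_cases ha : ∀ j F, ev t ≠ .setDeliver r j F
    · rw [stateAt, (next_loc_of_ne_setDeliver P _ ha).2.2, ih]
    · push Not at ha
      obtain ⟨j, F, hF⟩ := ha
      have h1 := round_succ_of_setDeliver (P := P) h
      have h2 := (hx.round_of_setDeliver h).2.1
      have h3 := (hx.round_of_setDeliver hF).2.1
      have h4 := (stateAt_extends P ev hut).round r
      have hij : i ≠ j := by simp only [Nat.succ_eq_add_one] at h4; omega
      simpa [stateAt, hF, next, hij] using ih

/-! ### What signatures and acceptance reveal about the past -/

theorem hashed_of_setDeliver {u t i : ℕ} {r : Fin n} {E : Finset Tx}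
    (h : ev u = .setDeliver r i E) (hut : u < t) :
    (P.toBatch E).1 ∈ (stateAt P ev t).hashed :=
  (stateAt_extends P ev hut).hashed (by simp [stateAt, h, next])

/-- Honest signatures are only issued on deliveries. -/
theorem exists_setDeliver_of_mem_issued {t : ℕ} {g : Signature Hash n}
    (h : g ∈ (stateAt P ev t).issued) :
    ∃ u < t, ∃ E, ev u = .setDeliver g.signer g.id E ∧ P.hash (P.toBatch E).1 = g.hash := by
  induction t with
  | zero => simp [stateAt, State.initial] at h
  | succ t ih =>
    by_cases h0 : g ∈ (stateAt P ev t).issued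
    · obtain ⟨u, hu, hE⟩ := ih h0
      exact ⟨u, by omega, hE⟩
    · rw [stateAt] at h
      rcases ha : ev t with _ | ⟨r, e⟩ | _ | _ | _ | ⟨r, i, E⟩ | _ | _ | _ | _
      case add =>
        by_cases hr : r ∈ P.byz ∨ ¬ P.valid e <;> simp [ha, next, hr, h0] at h
      case setDeliver =>
        simp [ha, next, h0] at h
        subst h
        exact ⟨t, by omega, E, ha, rfl⟩
      all_goals simp [ha, next, h0] at h

theorem IsExecution.posted_of_acceptedAt (hx : IsExecution P ev) {t : ℕ} {tag : SignedTag Hash n}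
    (h : AcceptedAt P ev t tag) :
    Certified P tag ∧ ∃ r, (r, tag) ∈ (stateAt P ev t).posted := by
  obtain ⟨h0, h⟩ := h
  have hen := hx.enabled t
  rw [stateAt] at h
  rcases ha : ev t with _ | ⟨r, e⟩ | _ | _ | _ | _ | _ | _ | ⟨r, tag'⟩ | _
  case add =>
    by_cases hr : r ∈ P.byz ∨ ¬ P.valid e <;> simp [ha, next, hr, h0] at h
  case execute =>
    simp only [ha, next, Set.mem_union, h0, false_or, Set.mem_ofPred_eq] at h
    obtain ⟨rfl, hc, -⟩ := h
    rw [ha] at hen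
    exact ⟨hc, r, hen⟩
  all_goals simp [ha, next, h0] at h

/-- A certified tag whose signatures are available carries an honest signature, hence names a set
that an honest replica has been delivered. -/
theorem exists_setDeliver_of_certified (hbyz : P.byz.card ≤ P.f) {t : ℕ}
    {tag : SignedTag Hash n} (hav : Available P (stateAt P ev t) tag) (hc : Certified P tag) :
    ∃ r, r ∉ P.byz ∧ ∃ u < t, ∃ E, ev u = .setDeliver r tag.id E ∧
      P.hash (P.toBatch E).1 = tag.hash := by
  obtain ⟨r, hr, hrb⟩ : ∃ r ∈ {r : Fin n | (⟨r, tag.id, tag.hash⟩ : Signature Hash n) ∈ tag.sig},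
      r ∉ (P.byz : Set (Fin n)) := by
    refine Set.exists_mem_notMem_of_ncard_lt_ncard ?_ (Set.toFinite _)
    rw [Set.ncard_coe_finset]
    exact lt_of_le_of_lt hbyz hc
  rw [Finset.mem_coe] at hrb
  rcases hav _ hr with h | h
  · exact absurd h hrb
  · exact ⟨r, hrb, exists_setDeliver_of_mem_issued h⟩

/-! ### Safety: unique batch, legality, availability -/

theorem uniqueBatch (hbyz : P.byz.card ≤ P.f) (hs : IsSBC P ev) : UniqueBatch P ev := by
  intro t tag₁ tag₂ h₁ h₂ c₁ c₂ hid
  obtain ⟨r₁, hr₁, u₁, -, E₁, e₁, hh₁⟩ := exists_setDeliver_of_certified hbyz h₁ c₁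
  obtain ⟨r₂, hr₂, u₂, -, E₂, e₂, hh₂⟩ := exists_setDeliver_of_certified hbyz h₂ c₂
  rw [← hid] at e₂
  rw [← hh₁, ← hh₂, hs.agreement _ _ _ _ _ _ _ hr₁ hr₂ e₁ e₂]

/-- By SBC validity and unforgeability, decided requests are valid and were added by L2 users. -/
theorem IsExecution.valid_added_of_setDeliver (hx : IsExecution P ev) (hs : IsSBC P ev)
    {u t i : ℕ} {r : Fin n} {E : Finset Tx} (h : ev u = .setDeliver r i E) (hut : u < t)
    {e : Tx} (he : e ∈ E) : P.valid e ∧ e ∈ (stateAt P ev t).added := by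
  obtain ⟨hv, v, hv', q, F, hF, heF⟩ :=
    (hs.validity i r u E (hx.round_of_setDeliver h).1 h).2 e he
  refine ⟨hv, (stateAt_extends P ev (hv'.trans hut).le).added ?_⟩
  by_cases hq : q ∈ P.byz
  · have := hx.enabled v
    rw [hF] at this
    simp only [Enabled, hq, if_true] at this
    exact this e heF hv
  · exact ((hx.sound v).known q e ((hx.round_of_propose hq hF).2.2.2 heF)).2

theorem legality (hbyz : P.byz.card ≤ P.f) (hx : IsExecution P ev) (hs : IsSBC P ev)
    (hcf : CollisionFree P ev) : Legality P ev := by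
  intro t q tag hp hc
  have hav := (hx.sound t).posted q tag hp
  obtain ⟨r, hr, u, hu, E, hE, hh⟩ := exists_setDeliver_of_certified hbyz hav hc
  rw [LegalAt]
  refine ⟨hc, (P.toBatch E).1, ⟨hashed_of_setDeliver hE hu, hh⟩, fun e he => ?_,
    (P.toBatch E).2.1, fun s hst tag' hacc _ hne b' hb' e he he' => ?_⟩
  · exact hx.valid_added_of_setDeliver hs hE hu (((P.toBatch E).2.2 e).1 he)
  · obtain ⟨hc', q', hp'⟩ := hx.posted_of_acceptedAt hacc
    have hav' := (hx.sound t).posted q' tag' ((stateAt_extends P ev hst.le).posted hp')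
    have hid : tag.id ≠ tag'.id := fun hid =>
      hne ⟨hid.symm, uniqueBatch hbyz hs t _ _ hav' hav hc' hc hid.symm⟩
    obtain ⟨r', hr', u', hu', E', hE', hh'⟩ := exists_setDeliver_of_certified hbyz hav' hc'
    obtain rfl : b' = (P.toBatch E').1 :=
      hcf t hb'.1 (hashed_of_setDeliver hE' hu') (hb'.2.trans hh'.symm)
    exact Finset.disjoint_left.1 (hs.integrity _ _ _ _ _ _ _ _ hr hr' hid hE hE')
      (((P.toBatch E).2.2 e).1 he) (((P.toBatch E').2.2 e).1 he')

theorem availability (hbyz : P.byz.card ≤ P.f) (hx : IsExecution P ev)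
    (hcf : CollisionFree P ev) : Availability P ev := by
  intro t q tag hp hl u b hb
  rw [LegalAt] at hl
  obtain ⟨r, hr, v, hv, E, hE, hh⟩ :=
    exists_setDeliver_of_certified hbyz ((hx.sound t).posted q tag hp) hl.1
  obtain rfl : b = (P.toBatch E).1 :=
    hcf (max t u) ((stateAt_extends P ev (le_max_right t u)).hashed hb.1)
      (hashed_of_setDeliver hE (hv.trans_le (le_max_left t u))) (hb.2.trans hh.symm)
  refine ⟨r, hr, fun t' ht' => ?_⟩
  have := hx.hashes_of_setDeliver hE (hv.trans_le ht')
  rw [hh] at this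
  simp only [translate, this]

/-! ### Liveness: requests are decided, decided rounds are posted -/

/-- Finitely many persistent facts that all eventually hold eventually hold together. -/
theorem exists_forall_of_forall_exists {ι : Type*} [Finite ι] {p : ι → ℕ → Prop}
    (hmono : ∀ i t u, t ≤ u → p i t → p i u) (h : ∀ i, ∃ t, p i t) : ∃ t, ∀ i, p i t := by
  choose T hT using h
  obtain ⟨M, hM⟩ := (Set.finite_range T).bddAbove
  exact ⟨M, fun i => hmono i _ _ (hM ⟨i, rfl⟩) (hT i)⟩

theorem IsExecution.eventually_mem_known (hx : IsExecution P ev) {t : ℕ} {r : Fin n} {e : Tx}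
    (hr : r ∉ P.byz) (he : P.valid e) (h : ev t = .add r e) :
    ∃ T, ∀ q, q ∉ P.byz → e ∈ ((stateAt P ev T).loc q).known := by
  apply exists_forall_of_forall_exists
    (fun q t u htu hk hq => (stateAt_extends P ev htu).known q (hk hq))
  intro q
  by_cases hq : q ∈ P.byz
  · exact ⟨0, fun h => absurd hq h⟩
  · have hnet : (r, q, Msg.elem e) ∈ (stateAt P ev (t + 1)).net := by
      simp [stateAt, h, next, hr, he]
    obtain ⟨u, hu⟩ := hx.delivery _ _ _ _ hr hq hnet
    exact ⟨u + 1, fun _ => by simp [stateAt, hu, next, he]⟩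

theorem IsExecution.lt_round_of_setDeliver (hx : IsExecution P ev) {u t i : ℕ} {r : Fin n}
    {E : Finset Tx} (h : ev u = .setDeliver r i E) (hut : u < t) :
    i < ((stateAt P ev t).loc r).round := by
  have h1 := round_succ_of_setDeliver (P := P) h
  have h2 := (hx.round_of_setDeliver h).2.1
  have h3 := (stateAt_extends P ev hut).round r
  simp only [Nat.succ_eq_add_one] at h3
  omega

/-- An element known to all honest replicas is decided: otherwise it stays pending, so that rounds
go on for ever and all honest replicas propose it in a late enough common round. -/
theorem IsExecution.exists_setDeliver_mem (hx : IsExecution P ev) (hs : IsSBC P ev) {T : ℕ}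
    {r : Fin n} {e : Tx} (hr : r ∉ P.byz) (he : P.valid e)
    (hk : ∀ q, q ∉ P.byz → e ∈ ((stateAt P ev T).loc q).known) :
    ∃ j q t E, q ∉ P.byz ∧ ev t = .setDeliver q j E ∧ e ∈ E := by
  by_contra hcon
  have hpend : ∀ q, q ∉ P.byz → ∀ t, T ≤ t → e ∈ ((stateAt P ev t).loc q).pending := by
    refine fun q hq t ht => ⟨(stateAt_extends P ev ht).known q (hk q hq), fun hd => hcon ?_⟩
    obtain ⟨u, i, E, hE, heE⟩ := exists_setDeliver_of_mem_decided hd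
    exact ⟨i, q, u, E, hq, hE, heE⟩
  have hround : ∀ N, ∃ t, T ≤ t ∧ N ≤ ((stateAt P ev t).loc r).round := by
    intro N
    induction N with
    | zero => exact ⟨T, le_rfl, Nat.zero_le _⟩
    | succ N ih =>
      obtain ⟨t, ht, hN⟩ := ih
      obtain ⟨t', ht', hp | ⟨i, E, hE⟩⟩ := hx.rounds r hr t e (hpend r hr t ht)
      · exact absurd (hpend r hr t' (ht.trans ht')) hp
      · have hi := (hx.round_of_propose hr hE).1
        have h1 := (stateAt_extends P ev ht').round r
        obtain ⟨u, F, hF⟩ := hs.termination i ⟨r, hr, t', E, hE⟩ r hr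
        have h2 := hx.lt_round_of_setDeliver hF (Nat.lt_succ_self u)
        refine ⟨max t (u + 1), ht.trans (le_max_left _ _), ?_⟩
        have h3 := (stateAt_extends P ev (le_max_right t (u + 1))).round r
        simp only [Nat.succ_eq_add_one] at h2
        omega
  obtain ⟨K, hK⟩ := (Set.finite_range fun q => ((stateAt P ev T).loc q).round).bddAbove
  -- All honest replicas propose in round `K + 1`, and do so only after time `T`.
  obtain ⟨t, -, ht⟩ := hround (K + 2)
  obtain ⟨u, -, E, hE⟩ := hx.exists_setDeliver_of_lt_round
    (show K + 1 < ((stateAt P ev t).loc r).round by omega)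
  obtain ⟨v, -, F, hF⟩ := hx.exists_propose_of_setDeliver hE
  refine hcon (hs.censorshipResistance e he ⟨K + 1, fun q hq => ?_⟩)
  obtain ⟨u', E', hE'⟩ := hs.termination (K + 1) ⟨r, hr, v, F, hF⟩ q hq
  obtain ⟨w, -, G, hG⟩ := hx.exists_propose_of_setDeliver hE'
  obtain ⟨hi, -, hsub, -⟩ := hx.round_of_propose hq hG
  refine ⟨w, G, hG, hsub (hpend q hq w ?_)⟩
  by_contra hlt
  have h1 := (stateAt_extends P ev (not_le.1 hlt).le).round q
  have h2 : ((stateAt P ev T).loc q).round ≤ K := hK ⟨q, rfl⟩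
  omega

/-- Once a round is decided at some honest replica, every honest replica eventually holds the
signatures of all honest replicas on the batch of that round. -/
theorem IsExecution.eventually_mem_signatures (hx : IsExecution P ev) (hs : IsSBC P ev)
    {u i : ℕ} {r p : Fin n} {E : Finset Tx} (h : ev u = .setDeliver r i E) (hp : p ∉ P.byz) :
    ∃ T, ∀ q, q ∉ P.byz →
      ⟨q, i, P.hash (P.toBatch E).1⟩ ∈ ((stateAt P ev T).loc p).signatures := by
  apply exists_forall_of_forall_exists
    (fun q t u htu hk hq => (stateAt_extends P ev htu).signatures p (hk hq))
  intro q
  by_cases hq : q ∈ P.byz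
  · exact ⟨0, fun h => absurd hq h⟩
  · have hr := (hx.round_of_setDeliver h).1
    obtain ⟨v, -, F, hF⟩ := hx.exists_propose_of_setDeliver h
    obtain ⟨w, G, hG⟩ := hs.termination i ⟨r, hr, v, F, hF⟩ q hq
    obtain rfl := hs.agreement _ _ _ _ _ _ _ hr hq h hG
    have hnet : (q, p, Msg.sig ⟨q, i, P.hash (P.toBatch E).1⟩) ∈ (stateAt P ev (w + 1)).net := by
      simp [stateAt, hG, next]
    obtain ⟨t, ht⟩ := hx.delivery _ _ _ _ hq hp hnet
    exact ⟨t + 1, fun _ => by simp [stateAt, ht, next]⟩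

/-- The honest replicas alone, being at least `2 f + 1`, can certify a tag. -/
theorem certified_of_honest (hbyz : P.byz.card ≤ P.f) (hf : 3 * P.f < n)
    {tag : SignedTag Hash n} (h : ∀ q, q ∉ P.byz → ⟨q, tag.id, tag.hash⟩ ∈ tag.sig) :
    Certified P tag := by
  have h1 : (P.byzᶜ : Finset (Fin n)).card = n - P.byz.card := by
    rw [Finset.card_compl, Fintype.card_fin]
  have h2 : (P.byzᶜ : Finset (Fin n)).card ≤
      {r : Fin n | (⟨r, tag.id, tag.hash⟩ : Signature Hash n) ∈ tag.sig}.ncard := by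
    rw [← Set.ncard_coe_finset]
    exact Set.ncard_le_ncard (fun q hq => h q (by simpa using hq)) (Set.toFinite _)
  rw [Certified]
  omega

/-- Executing a posted certified tag leaves its identifier taken in the `logger`. -/
theorem IsExecution.exists_accepted_of_posted (hx : IsExecution P ev) {t : ℕ} {r : Fin n}
    {tag : SignedTag Hash n} (h : (r, tag) ∈ (stateAt P ev t).posted) (hc : Certified P tag) :
    ∃ u, ∃ tag' ∈ (stateAt P ev u).accepted, tag'.id = tag.id := by
  obtain ⟨u, hu⟩ := hx.liveL1 t r tag h
  by_cases hold : ∀ old ∈ (stateAt P ev u).accepted, old.id ≠ tag.id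
  · exact ⟨u + 1, tag, by simpa [stateAt, hu, next, hc] using Or.inr hold, rfl⟩
  · push Not at hold
    exact ⟨u, hold⟩

/-- Every identifier of a decided round is eventually taken in the `logger`: when all smaller
identifiers are taken and enough signatures have arrived, the next honest turn posts a tag. -/
theorem IsExecution.exists_accepted_of_setDeliver (hbyz : P.byz.card ≤ P.f) (hf : 3 * P.f < n)
    (hx : IsExecution P ev) (hs : IsSBC P ev) {u j : ℕ} {r : Fin n} {E : Finset Tx}
    (h : ev u = .setDeliver r j E) :
    ∃ t, ∃ tag ∈ (stateAt P ev t).accepted, tag.id = j := by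
  induction j using Nat.strong_induction_on generalizing u E with
  | _ j ih =>
    by_contra hcon
    have hr := (hx.round_of_setDeliver h).1
    obtain ⟨T₁, hT₁⟩ : ∃ T, ∀ i : Fin j, ∃ tag ∈ (stateAt P ev T).accepted, tag.id = i := by
      refine exists_forall_of_forall_exists (fun i t v htv hi => ?_) fun i => ?_
      · obtain ⟨tag, hacc, hid⟩ := hi
        exact ⟨tag, (stateAt_extends P ev htv).accepted hacc, hid⟩
      · obtain ⟨v, -, F, hF⟩ := hx.exists_setDeliver_of_lt_round
          (i.2.trans_eq (hx.round_of_setDeliver h).2.1)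
        exact ih i i.2 hF
    obtain ⟨T₂, hT₂⟩ := hx.eventually_mem_signatures hs h hr
    obtain ⟨t, ht, hturn⟩ := hx.turns r hr (max T₁ T₂)
    let d := P.hash (P.toBatch E).1
    let tag : SignedTag Hash n :=
      ⟨j, d, {g | g ∈ ((stateAt P ev t).loc r).signatures ∧ g.id = j ∧ g.hash = d}⟩
    have hc : Certified P tag := certified_of_honest hbyz hf fun q hq =>
      ⟨(stateAt_extends P ev ((le_max_right T₁ T₂).trans ht)).signatures r (hT₂ q hq), rfl, rfl⟩
    have hnext : IsNextBatch (stateAt P ev t) j := by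
      refine ⟨fun tag' hacc hid => hcon ⟨t, tag', hacc, hid⟩, fun i hi => ?_⟩
      by_contra hlt
      obtain ⟨tag', hacc, hid⟩ := hT₁ ⟨i, not_le.1 hlt⟩
      exact hi tag' ((stateAt_extends P ev ((le_max_left T₁ T₂).trans ht)).accepted hacc) hid
    have hpost : (r, tag) ∈ (stateAt P ev (t + 1)).posted := by
      rw [stateAt, hturn]
      exact Or.inr ⟨rfl, hnext, rfl, hc⟩
    exact hcon (hx.exists_accepted_of_posted hpost hc)

theorem exists_acceptedAt {t : ℕ} {tag : SignedTag Hash n}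
    (h : tag ∈ (stateAt P ev t).accepted) : ∃ s, AcceptedAt P ev s tag := by
  induction t with
  | zero => simp [stateAt, State.initial] at h
  | succ t ih =>
    by_cases h0 : tag ∈ (stateAt P ev t).accepted
    · exact ih h0
    · exact ⟨t, h0, h⟩

theorem termination (hbyz : P.byz.card ≤ P.f) (hf : 3 * P.f < n) (hx : IsExecution P ev)
    (hs : IsSBC P ev) (hcf : CollisionFree P ev) : Termination P ev := by
  intro t r e hr he h
  obtain ⟨T, hT⟩ := hx.eventually_mem_known hr he h
  obtain ⟨j, q, u, E, hq, hE, heE⟩ := hx.exists_setDeliver_mem hs hr he hT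
  obtain ⟨v, tag, hacc, hid⟩ := hx.exists_accepted_of_setDeliver hbyz hf hs hE
  obtain ⟨s, has⟩ := exists_acceptedAt hacc
  obtain ⟨hc, p, hp⟩ := hx.posted_of_acceptedAt has
  obtain ⟨r', hr', w, hw, E', hE', hh⟩ :=
    exists_setDeliver_of_certified hbyz ((hx.sound s).posted p tag hp) hc
  rw [hid] at hE'
  obtain rfl := hs.agreement _ _ _ _ _ _ _ hq hr' hE hE'
  exact ⟨s, tag, (P.toBatch E).1, ⟨p, hp⟩, has, legality hbyz hx hs hcf s p tag hp hc,
    ⟨hashed_of_setDeliver hE' hw, hh⟩, ((P.toBatch E).2.2 e).2 heE⟩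

end Arranger

theorem mainTheorem2 {Tx Hash : Type*} {n : ℕ} (P : Arranger.Params Tx Hash n)
    (hbyz : P.byz.card ≤ P.f) (hf : 3 * P.f < n) : Arranger.Correct P := by
  intro ev hx hs hcf
  exact ⟨Arranger.legality hbyz hx hs hcf, Arranger.uniqueBatch hbyz hs,
    Arranger.termination hbyz hf hx hs hcf, Arranger.availability hbyz hx hcf⟩
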